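/- Let $f(\ell,x)$, $\ell,x\in\mathbb{Z}_+$, be positive numbers such that $\ell\mapsto f(\ell,x)$ is non-decreasing for every $x$. Let $\mathbf{X}=(X_n)_{n\ge 0}$ be the edge-reinforced random walk on $\mathbb{Z}_+=\{0,1,2,\dots\}$ with reinforcement scheme $f$ and arbitrary initial position: it jumps to a nearest neighbour at each step, and $$\mathbb{P}(X_{n+1}=X_n+1\mid X_0,\dots,X_n)=1-\mathbb{P}(X_{n+1}=X_n-1\mid X_0,\dots,X_n)=\frac{w_n(X_n)}{w_n(X_n-1)+w_n(X_n)},$$ where $w_n(-1)=0$, $w_n(x)=f(\phi_n(x),x)$ for $x\in\mathbb{Z}_+$, and $\phi_n(x)$ is the number of $i\in\{1,\dots,n\}$ with $\{X_{i-1},X_i\}=\{x,x+1\}$. Suppose that the reinforcement is of factor type, i.e. $f(\ell,x)=\delta_\ell\, f(0,x)$ for all $\ell,x\in\mathbb{Z}_+$, where $(\delta_\ell)_{\ell\ge 0}$ is a positive non-decreasing sequence with $\delta_0=1$, and that $\delta$ is of down-only type, i.e. moreover $\delta_{2k}=\delta_{2k+1}$ for all $k\in\mathbb{Z}_+$. Assume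 that $$\sum_{x=0}^\infty \frac{1}{f(0,x)^2}<\infty,\qquad \sum_{x=0}^\infty\frac{1}{f(0,x)}=\infty .$$ If $\sum_{k=0}^\infty\delta_{2k}^{-2}<\infty$ and $\sum_{k=0}^\infty\delta_{2k}^{-1}=\infty$, then $\mathbf{X}$ is transient almost surely, that is, almost surely every vertex is visited only finitely many times. -/

import Mathlib

open MeasureTheory ProbabilityTheory
open scoped ENNReal

namespace ERRW

/-- `traversals X n x` is the number of traversals of the non-oriented edge `{x, x+1}` by the
path `X` up to time `n`. -/
def traversals (X : ℕ → ℕ) (n x : ℕ) : ℕ :=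
  ((Finset.range n).filter fun i => s(X i, X (i + 1)) = s(x, x + 1)).card

/-- The weight `w_n(x) = f(φ_n(x), x)` of the edge `{x, x+1}` at time `n` along the path `X`. -/
def weight (f : ℕ → ℕ → ℝ) (X : ℕ → ℕ) (n x : ℕ) : ℝ :=
  f (traversals X n x) x

/-- The weight at time `n` of the edge to the left of the vertex `x`, that is `w_n(x - 1)`,
with the convention `w_n(-1) = 0` (reflection at the origin). -/
def leftWeight (f : ℕ → ℕ → ℝ) (X : ℕ → ℕ) (n : ℕ) : ℕ → ℝ
  | 0 => 0
  | x + 1 => weight f X n x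

/-- `w_n(X_n) / (w_n(X_n - 1) + w_n(X_n))`. -/
noncomputable def upProb (f : ℕ → ℕ → ℝ) (X : ℕ → ℕ) (n : ℕ) : ℝ :=
  weight f X n (X n) / (leftWeight f X n (X n) + weight f X n (X n))

/-- For every vertex `x`, `(f(ℓ, x))_ℓ` is a non-decreasing sequence of positive numbers. -/
structure IsReinforcementScheme (f : ℕ → ℕ → ℝ) : Prop where
  pos : ∀ ℓ x, 0 < f ℓ x
  mono : ∀ x, Monotone fun ℓ => f ℓ x

/-- The σ-algebra generated by `X_0, …, X_n`. -/
abbrev history {Ω : Type*} (X : ℕ → Ω → ℕ) (n : ℕ) : MeasurableSpace Ω :=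
  ⨆ i ≤ n, MeasurableSpace.comap (X i) ⊤

/-- `X` is an edge-reinforced random walk on `ℤ₊` with reinforcement scheme `f`: it jumps to
nearest neighbours and, given the history up to time `n`, it jumps to the right with probability
`w_n(X_n) / (w_n(X_n - 1) + w_n(X_n))`. The initial position is arbitrary. -/
structure IsERRW {Ω : Type*} [MeasurableSpace Ω] (P : Measure Ω) (f : ℕ → ℕ → ℝ)
    (X : ℕ → Ω → ℕ) : Prop where
  scheme : IsReinforcementScheme f
  measurable : ∀ n, Measurable (X n)
  nearest_neighbour : ∀ n, ∀ᵐ ω ∂P, X (n + 1) ω = X n ω + 1 ∨ X (n + 1) ω + 1 = X n ω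
  condProb_up : ∀ n,
    P⟦{ω | X (n + 1) ω = X n ω + 1} | history X n⟧ =ᵐ[P] fun ω => upProb f (fun m => X m ω) n

/-- The path visits every point only finitely many times. -/
def IsTransientPath (X : ℕ → ℕ) : Prop :=
  ∀ x, {n | X n = x}.Finite

/-- `F_ℓ^{(k)} = ∑_y (1 / f(ℓ, y))^k`, with values in `[0, ∞]`. -/
noncomputable def F (f : ℕ → ℕ → ℝ) (ℓ k : ℕ) : ℝ≥0∞ :=
  ∑' y, ENNReal.ofReal ((1 / f ℓ y) ^ k)

/-- Factor type reinforcement with factor sequence `δ`. -/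
structure IsFTR (f : ℕ → ℕ → ℝ) (δ : ℕ → ℝ) : Prop where
  pos : ∀ ℓ, 0 < δ ℓ
  mono : Monotone δ
  zero : δ 0 = 1
  factor : ∀ ℓ x, f ℓ x = δ ℓ * f 0 x

/-- Down-only type sequences. -/
structure IsDownOnly (δ : ℕ → ℝ) : Prop where
  even_odd : ∀ k, δ (2 * k) = δ (2 * k + 1)
  mono : Monotone δ
  zero : δ 0 = 1

end ERRW

/-! Fix a vertex x at or to the right of the start and follow R_n, the resistance (sum of 1/w_n) of
the edges between x and X_n, with R_n = 0 when X_n ≤ x. Down-only reinforcement makes an up-step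
leave the weights unchanged, while the edge crossed by a down-step drops out of the sum. So R_n
changes by 1/w_n(X_n) or -1/w_n(X_n - 1), with no correction (`sum_resistanceIncrement`). The jump
probabilities make this increment centred off x, with mean 1/(w_n(x-1) + w_n(x)) at x
(`IsERRW.condExp_restrictedIncrement`).

Each crossing uses a new pair (count, edge), so the squared increments sum to at most ∑ 1/f(j,y)²,
which is finite by the two square-summability assumptions. Hence R minus its compensator converges
almost surely (`ae_exists_tendsto_sum_sub_condExp`). At visits to x, R vanishes, so along infinitely
many visits the compensator would stay bounded. But the total weight at x after k visits is at most
a constant times δ_{2k}, and ∑ 1/δ_{2k} = ∞ sends the compensator to infinity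
(`tendsto_sum_inv_weights`). So x is visited finitely often.

The same divergence and conditional Borel–Cantelli carry infinitely many visits from x to x+1
(`IsERRW.ae_infinite_visits_succ`), which rules out recurrence to the left of the start as well. -/

namespace ERRW

open Filter Topology Finset

/-! ### Convergence of centred sums with bounded square function -/

section Martingale

variable {Ω : Type*} {m0 : MeasurableSpace Ω} {μ : Measure Ω}

/-- The centred variable `Y - μ[Y | m]` is orthogonal to square-integrable `m`-measurable
variables. -/
lemma integral_mul_sub_condExp_eq_zero [IsProbabilityMeasure μ] {m : MeasurableSpace Ω}
    (hm : m ≤ m0) {Z Y : Ω → ℝ} (hZm : StronglyMeasurable[m] Z) (hZ : MemLp Z 2 μ)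
    (hY : MemLp Y 2 μ) : ∫ ω, Z ω * (Y ω - (μ[Y | m]) ω) ∂μ = 0 := by
  have hYi : Integrable Y μ := hY.integrable one_le_two
  have hZY : Integrable (Z * Y) μ := hZ.integrable_mul hY
  have hpull : μ[Z * Y | m] =ᵐ[μ] Z * μ[Y | m] :=
    condExp_mul_of_stronglyMeasurable_left hZm hZY hYi
  have hZE : Integrable (Z * μ[Y | m]) μ := integrable_condExp.congr hpull
  have h : ∫ ω, (Z * Y) ω ∂μ = ∫ ω, (Z * μ[Y | m]) ω ∂μ := by
    rw [← integral_condExp hm]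
    exact integral_congr_ae hpull
  calc ∫ ω, Z ω * (Y ω - (μ[Y | m]) ω) ∂μ
      = ∫ ω, ((Z * Y) ω - (Z * μ[Y | m]) ω) ∂μ := by
        refine integral_congr_ae (ae_of_all _ fun ω => ?_)
        simp [mul_sub]
    _ = 0 := by rw [integral_sub hZY hZE, h, sub_self]

/-- Pythagoras in L²: Y splits orthogonally into its conditional expectation and the centred part.
-/
lemma integral_sub_condExp_sq_le [IsProbabilityMeasure μ] {m : MeasurableSpace Ω}
    (hm : m ≤ m0) {Y : Ω → ℝ} (hY : MemLp Y 2 μ) :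
    ∫ ω, (Y ω - (μ[Y | m]) ω) ^ 2 ∂μ ≤ ∫ ω, Y ω ^ 2 ∂μ := by
  have hE : MemLp (μ[Y | m]) 2 μ := hY.condExp one_le_two
  have hD : MemLp (fun ω => Y ω - (μ[Y | m]) ω) 2 μ := hY.sub hE
  have h0 := integral_mul_sub_condExp_eq_zero hm stronglyMeasurable_condExp hE hY
  have hint : Integrable (fun ω => (μ[Y | m]) ω * (Y ω - (μ[Y | m]) ω)) μ := hE.integrable_mul hD
  calc ∫ ω, (Y ω - (μ[Y | m]) ω) ^ 2 ∂μ
      = ∫ ω, ((Y ω - (μ[Y | m]) ω) ^ 2 + 2 * ((μ[Y | m]) ω * (Y ω - (μ[Y | m]) ω))) ∂μ := by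
        rw [integral_add hD.integrable_sq (hint.const_mul 2), integral_const_mul, h0]
        simp
    _ ≤ ∫ ω, Y ω ^ 2 ∂μ := by
        refine integral_mono (hD.integrable_sq.add (hint.const_mul 2)) hY.integrable_sq fun ω => ?_
        nlinarith [sq_nonneg ((μ[Y | m]) ω)]

/-- If the square function `∑ Yᵢ²` of an adapted sequence is bounded, then the sum of the
centred variables `Yᵢ - μ[Yᵢ | ℱᵢ]` converges almost surely. -/
theorem ae_exists_tendsto_sum_sub_condExp [IsProbabilityMeasure μ] {ℱ : Filtration ℕ m0}
    {Y : ℕ → Ω → ℝ} (hY : ∀ n, StronglyMeasurable[ℱ (n + 1)] (Y n)) {K : ℝ}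
    (hK : ∀ n, ∀ᵐ ω ∂μ, ∑ i ∈ range n, Y i ω ^ 2 ≤ K) :
    ∀ᵐ ω ∂μ, ∃ c, Tendsto (fun n => ∑ i ∈ range n, (Y i ω - (μ[Y i | ℱ i]) ω)) atTop (𝓝 c) := by
  -- A single term of the square function is at most K, so each variable is bounded by √K.
  have hL : ∀ n, MemLp (Y n) 2 μ := fun n => by
    refine MemLp.of_bound ((hY n).mono (ℱ.le _)).aestronglyMeasurable (Real.sqrt K) ?_
    filter_upwards [hK (n + 1)] with ω hω
    rw [Real.norm_eq_abs]
    refine Real.abs_le_sqrt (le_trans ?_ hω)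
    exact single_le_sum (f := fun i => Y i ω ^ 2) (fun i _ => sq_nonneg _) (self_mem_range_succ n)
  set ξ : ℕ → Ω → ℝ := fun n ω => Y n ω - (μ[Y n | ℱ n]) ω with hξ
  set N : ℕ → Ω → ℝ := fun n ω => ∑ i ∈ range n, ξ i ω with hN
  have hξL : ∀ n, MemLp (ξ n) 2 μ := fun n => (hL n).sub ((hL n).condExp one_le_two)
  have hNL : ∀ n, MemLp (N n) 2 μ := fun n => memLp_finsetSum _ fun i _ => hξL i
  have hξm : ∀ n, StronglyMeasurable[ℱ (n + 1)] (ξ n) := fun n =>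
    (hY n).sub (stronglyMeasurable_condExp.mono (ℱ.mono n.le_succ))
  have hNm : StronglyAdapted ℱ N := fun n =>
    Finset.stronglyMeasurable_fun_sum _ fun i hi => (hξm i).mono (ℱ.mono (mem_range.1 hi))
  have hNsucc : ∀ n, N (n + 1) = N n + ξ n := fun n => by
    ext ω; simp [hN, sum_range_succ]
  have hmart : Martingale N ℱ μ := by
    refine martingale_nat hNm (fun n => (hNL n).integrable one_le_two) fun n => ?_
    have h1 : μ[N (n + 1) | ℱ n] =ᵐ[μ] μ[N n | ℱ n] + μ[ξ n | ℱ n] := by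
      rw [hNsucc]
      exact condExp_add ((hNL n).integrable one_le_two) ((hξL n).integrable one_le_two) _
    have h2 : μ[ξ n | ℱ n] =ᵐ[μ] μ[Y n | ℱ n] - μ[μ[Y n | ℱ n] | ℱ n] :=
      condExp_sub ((hL n).integrable one_le_two) integrable_condExp _
    rw [condExp_of_stronglyMeasurable (ℱ.le n) (hNm n) ((hNL n).integrable one_le_two)] at h1
    rw [condExp_of_stronglyMeasurable (ℱ.le n) stronglyMeasurable_condExp integrable_condExp] at h2
    filter_upwards [h1, h2] with ω h1 h2
    simp [h1, h2]
  have hsq : ∀ n, ∫ ω, N n ω ^ 2 ∂μ ≤ ∫ ω, ∑ i ∈ range n, Y i ω ^ 2 ∂μ := by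
    intro n
    induction n with
    | zero => simp [hN]
    | succ n ih =>
      -- Orthogonality of martingale increments: second moments add up.
      have hcross : ∫ ω, N n ω * ξ n ω ∂μ = 0 :=
        integral_mul_sub_condExp_eq_zero (ℱ.le n) (hNm n) (hNL n) (hL n)
      have hci : Integrable (fun ω => N n ω * ξ n ω) μ := (hNL n).integrable_mul (hξL n)
      have hexp : ∫ ω, N (n + 1) ω ^ 2 ∂μ
          = ∫ ω, N n ω ^ 2 ∂μ + 2 * ∫ ω, N n ω * ξ n ω ∂μ + ∫ ω, ξ n ω ^ 2 ∂μ := by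
        have hi : Integrable (fun ω => N n ω ^ 2 + 2 * (N n ω * ξ n ω)) μ :=
          (hNL n).integrable_sq.add (hci.const_mul 2)
        rw [← integral_const_mul, ← integral_add (hNL n).integrable_sq (hci.const_mul 2),
          ← integral_add hi (hξL n).integrable_sq]
        refine integral_congr_ae (ae_of_all _ fun ω => ?_)
        simp only [hNsucc, Pi.add_apply]
        ring
      rw [hexp, hcross]
      simp_rw [sum_range_succ]
      rw [integral_add (integrable_finsetSum _ fun i _ => (hL i).integrable_sq)
        (hL n).integrable_sq]
      have := integral_sub_condExp_sq_le (ℱ.le n) (hL n)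
      simp only [hξ]
      linarith
  have hsqK : ∀ n, ∫ ω, N n ω ^ 2 ∂μ ≤ K := fun n => by
    refine (hsq n).trans ?_
    calc ∫ ω, ∑ i ∈ range n, Y i ω ^ 2 ∂μ ≤ ∫ _, K ∂μ :=
          integral_mono_ae (integrable_finsetSum _ fun i _ => (hL i).integrable_sq)
            (integrable_const _) (hK n)
      _ = K := by simp
  -- Doob's theorem needs an L¹ bound, which follows from the L² bound K by |a| ≤ 1 + a².
  refine hmart.submartingale.exists_ae_tendsto_of_bdd (R := (1 + K).toNNReal) fun n => ?_
  rw [eLpNorm_one_eq_lintegral_enorm,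
    ← ofReal_integral_norm_eq_lintegral_enorm ((hNL n).integrable one_le_two)]
  refine ENNReal.ofReal_le_ofReal ?_
  calc ∫ ω, ‖N n ω‖ ∂μ ≤ ∫ ω, (1 + N n ω ^ 2) ∂μ := by
        refine integral_mono ((hNL n).integrable one_le_two).norm
          ((integrable_const _).add (hNL n).integrable_sq) fun ω => ?_
        simp only [Real.norm_eq_abs]
        nlinarith [sq_abs (N n ω), sq_nonneg (|N n ω| - 1), abs_nonneg (N n ω)]
    _ ≤ 1 + K := by
        rw [integral_add (integrable_const _) (hNL n).integrable_sq]
        simpa using hsqK n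

end Martingale

/-! ### Deterministic properties of nearest-neighbour paths -/

section Path

variable {f : ℕ → ℕ → ℝ} {δ : ℕ → ℝ} {X : ℕ → ℕ} {x n : ℕ}

/-- The path jumps to a nearest neighbour at each step. -/
def IsNearestNeighbourPath (X : ℕ → ℕ) : Prop :=
  ∀ n, X (n + 1) = X n + 1 ∨ X (n + 1) + 1 = X n

/-- The resistance of the edge to the right of the current position, if it is an edge of
`[x, ∞)`. -/
noncomputable def rightResistance (f : ℕ → ℕ → ℝ) (x : ℕ) (X : ℕ → ℕ) (n : ℕ) : ℝ :=
  if x ≤ X n then (weight f X n (X n))⁻¹ else 0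

/-- The resistance of the edge to the left of the current position, if it is an edge of
`[x, ∞)`. -/
noncomputable def leftResistance (f : ℕ → ℕ → ℝ) (x : ℕ) (X : ℕ → ℕ) (n : ℕ) : ℝ :=
  if x < X n then (leftWeight f X n (X n))⁻¹ else 0

/-- The increment at step `n` of the resistance between `x` and the current position. -/
noncomputable def resistanceIncrement (f : ℕ → ℕ → ℝ) (x : ℕ) (X : ℕ → ℕ) (n : ℕ) : ℝ :=
  if X (n + 1) = X n + 1 then rightResistance f x X n else -leftResistance f x X n

/-- The number of visits to `x` strictly before time `n`. -/
def visits (X : ℕ → ℕ) (x n : ℕ) : ℕ :=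
  ((range n).filter fun i => X i = x).card

/-! ### Edge counts, visit counts and the effect of one step -/

lemma traversals_zero (X : ℕ → ℕ) (y : ℕ) : traversals X 0 y = 0 := by
  simp [traversals]

lemma traversals_succ (X : ℕ → ℕ) (n y : ℕ) :
    traversals X (n + 1) y
      = traversals X n y + if s(X n, X (n + 1)) = s(y, y + 1) then 1 else 0 := by
  unfold traversals
  rw [range_add_one, filter_insert]
  split_ifs <;> simp

lemma traversals_succ_of_up (h : X (n + 1) = X n + 1) (y : ℕ) :
    traversals X (n + 1) y = traversals X n y + if y = X n then 1 else 0 := by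
  rw [traversals_succ, h]
  congr 2
  simp only [Sym2.eq_iff, eq_iff_iff]
  omega

lemma traversals_succ_of_down (h : X (n + 1) + 1 = X n) (y : ℕ) :
    traversals X (n + 1) y = traversals X n y + if y = X (n + 1) then 1 else 0 := by
  rw [traversals_succ, ← h]
  congr 2
  simp only [Sym2.eq_iff, eq_iff_iff]
  omega

lemma visits_succ (X : ℕ → ℕ) (x n : ℕ) :
    visits X x (n + 1) = visits X x n + if X n = x then 1 else 0 := by
  unfold visits
  rw [range_add_one, filter_insert]
  split_ifs <;> simp

/-- An edge to the right of the starting point has been traversed an odd number of times exactly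
when the walk is to the right of it. -/
lemma odd_traversals_iff (hX : IsNearestNeighbourPath X) {y : ℕ} (hy : X 0 ≤ y) (n : ℕ) :
    Odd (traversals X n y) ↔ y < X n := by
  induction n with
  | zero => simp [traversals_zero, hy]
  | succ n ih =>
    rcases hX n with h | h
    · rw [traversals_succ_of_up h]
      split_ifs with hyn
      · rw [Nat.odd_add_one, ih]; omega
      · rw [add_zero, ih]; omega
    · rw [traversals_succ_of_down h]
      split_ifs with hyn
      · rw [Nat.odd_add_one, ih]; omega
      · rw [add_zero, ih]; omega

/-- For down-only reinforcement, an up-step to the right of the starting point does not change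
the weights. -/
lemma weight_succ_of_up (hf : IsFTR f δ) (hδ : IsDownOnly δ) (hX : IsNearestNeighbourPath X)
    (h0 : X 0 ≤ X n) (h : X (n + 1) = X n + 1) (y : ℕ) :
    weight f X (n + 1) y = weight f X n y := by
  unfold weight
  rw [traversals_succ_of_up h]
  split_ifs with hyn
  · subst hyn
    -- The walk stands at the left end of the edge, so the count moves from some 2k to 2k + 1, where
    -- δ is constant.
    have hev : ¬ Odd (traversals X n (X n)) := by simp [odd_traversals_iff hX h0]
    obtain ⟨k, hk⟩ := even_iff_exists_two_mul.1 (Nat.not_odd_iff_even.1 hev)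
    rw [hk, hf.factor, hf.factor (2 * k), hδ.even_odd]
  · rfl

lemma weight_succ_of_down (h : X (n + 1) + 1 = X n) {y : ℕ} (hy : y ≠ X (n + 1)) :
    weight f X (n + 1) y = weight f X n y := by
  simp [weight, traversals_succ_of_down h, hy]

lemma leftWeight_of_pos {z : ℕ} (hz : 0 < z) : leftWeight f X n z = weight f X n (z - 1) := by
  obtain ⟨z, rfl⟩ := Nat.exists_eq_succ_of_ne_zero hz.ne'
  rfl

/-- The increments sum up to the resistance between `x` and the current position. -/
lemma sum_resistanceIncrement (hf : IsFTR f δ) (hδ : IsDownOnly δ) (hX : IsNearestNeighbourPath X)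
    (h0 : X 0 ≤ x) (n : ℕ) :
    ∑ i ∈ range n, resistanceIncrement f x X i = ∑ y ∈ Ico x (X n), (weight f X n y)⁻¹ := by
  induction n with
  | zero => simp [h0]
  | succ n ih =>
    rw [sum_range_succ, ih]
    rcases hX n with h | h
    · rw [resistanceIncrement, if_pos h, rightResistance]
      split_ifs with hx
      · rw [h, sum_Ico_succ_top hx]
        simp_rw [weight_succ_of_up hf hδ hX (h0.trans hx) h]
      · rw [Ico_eq_empty (by omega), Ico_eq_empty (by omega)]
        simp
    · rw [resistanceIncrement, if_neg (by omega), leftResistance]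
      split_ifs with hx
      -- The crossed edge was the top term of the sum and now lies outside it, so its increased
      -- weight never enters.
      · rw [leftWeight_of_pos (by omega), ← h, sum_Ico_succ_top (by omega), Nat.add_sub_cancel,
          add_neg_cancel_right]
        refine sum_congr rfl fun y hy => ?_
        rw [weight_succ_of_down h (by have := mem_Ico.1 hy; omega)]
      · rw [Ico_eq_empty (by omega), Ico_eq_empty (by omega)]
        simp

/-- The squared increment is dominated by the squared resistance of the traversed edge. -/
lemma sq_resistanceIncrement_le (hX : IsNearestNeighbourPath X) (n : ℕ) :
    ∃ e, (∀ y, traversals X (n + 1) y = traversals X n y + if y = e then 1 else 0) ∧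
      resistanceIncrement f x X n ^ 2 ≤ (weight f X n e)⁻¹ ^ 2 := by
  rcases hX n with h | h
  · refine ⟨X n, traversals_succ_of_up h, ?_⟩
    rw [resistanceIncrement, if_pos h, rightResistance]
    split_ifs
    · exact le_rfl
    · simpa using sq_nonneg (weight f X n (X n))
  · refine ⟨X (n + 1), traversals_succ_of_down h, ?_⟩
    rw [resistanceIncrement, if_neg (by omega), leftResistance]
    split_ifs
    · rw [leftWeight_of_pos (by omega), ← h, Nat.add_sub_cancel, neg_sq]
    · simpa using sq_nonneg (weight f X n (X (n + 1)))

/-- A step across `e` made at count j is charged to the pair (j, `e`). The count then increases, so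
no pair is charged twice. -/
lemma sum_ofReal_sq_resistanceIncrement_le (hX : IsNearestNeighbourPath X) (n : ℕ) :
    ∑ i ∈ range n, ENNReal.ofReal (resistanceIncrement f x X i ^ 2)
      ≤ ∑' y, ∑' j, ENNReal.ofReal ((f j y)⁻¹ ^ 2) := by
  have key : ∑ i ∈ range n, ENNReal.ofReal (resistanceIncrement f x X i ^ 2)
      ≤ ∑' y, ∑ j ∈ range (traversals X n y), ENNReal.ofReal ((f j y)⁻¹ ^ 2) := by
    induction n with
    | zero => simp
    | succ n ih =>
      obtain ⟨e, he, hle⟩ := sq_resistanceIncrement_le (f := f) (x := x) hX n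
      have hsplit : ∀ y, ∑ j ∈ range (traversals X (n + 1) y), ENNReal.ofReal ((f j y)⁻¹ ^ 2)
          = ∑ j ∈ range (traversals X n y), ENNReal.ofReal ((f j y)⁻¹ ^ 2)
            + if y = e then ENNReal.ofReal ((weight f X n e)⁻¹ ^ 2) else 0 := by
        intro y
        rw [he]
        split_ifs with hy
        · rw [sum_range_succ, hy]; rfl
        · simp
      simp_rw [hsplit]
      rw [ENNReal.tsum_add, tsum_ite_eq, sum_range_succ]
      exact add_le_add ih (ENNReal.ofReal_le_ofReal hle)
  exact key.trans (ENNReal.tsum_le_tsum fun y => ENNReal.sum_le_tsum _)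

/-- The double series factors as `F f 0 2` times ∑ 1/δ_j², and the odd terms of the latter repeat
the even ones. -/
lemma tsum_tsum_sq_inv_lt_top (hf : IsFTR f δ) (hδ : IsDownOnly δ) (hF2 : F f 0 2 < ⊤)
    (hδ2 : ∑' k : ℕ, ENNReal.ofReal ((δ (2 * k))⁻¹ ^ 2) < ⊤) :
    ∑' y, ∑' j, ENNReal.ofReal ((f j y)⁻¹ ^ 2) < ⊤ := by
  have hfac : ∀ y j, ENNReal.ofReal ((f j y)⁻¹ ^ 2)
      = ENNReal.ofReal ((1 / f 0 y) ^ 2) * ENNReal.ofReal ((δ j)⁻¹ ^ 2) := by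
    intro y j
    rw [← ENNReal.ofReal_mul (sq_nonneg _), hf.factor j y, mul_inv, mul_pow, one_div, mul_comm]
  simp_rw [hfac, ENNReal.tsum_mul_left, ENNReal.tsum_mul_right]
  refine ENNReal.mul_lt_top hF2 ?_
  rw [← tsum_even_add_odd ENNReal.summable ENNReal.summable]
  simp_rw [← hδ.even_odd]
  exact ENNReal.add_lt_top.2 ⟨hδ2, hδ2⟩

lemma exists_sum_sq_resistanceIncrement_le (hf : IsFTR f δ) (hδ : IsDownOnly δ)
    (hF2 : F f 0 2 < ⊤) (hδ2 : ∑' k : ℕ, ENNReal.ofReal ((δ (2 * k))⁻¹ ^ 2) < ⊤) :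
    ∃ K : ℝ, 0 ≤ K ∧ ∀ (x : ℕ) (X : ℕ → ℕ), IsNearestNeighbourPath X →
      ∀ n, ∑ i ∈ range n, resistanceIncrement f x X i ^ 2 ≤ K := by
  have htop := tsum_tsum_sq_inv_lt_top hf hδ hF2 hδ2
  refine ⟨(∑' y, ∑' j, ENNReal.ofReal ((f j y)⁻¹ ^ 2)).toReal, ENNReal.toReal_nonneg,
    fun x X hX n => ?_⟩
  rw [← ENNReal.ofReal_le_iff_le_toReal htop.ne,
    ENNReal.ofReal_sum_of_nonneg fun i _ => sq_nonneg _]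
  exact sum_ofReal_sq_resistanceIncrement_le hX n

/-- Each squared resistance is one term of the finite double series. The uniform bound supplies
integrability in the conditional expectations. -/
lemma exists_inv_le (hf : IsFTR f δ) (hδ : IsDownOnly δ) (hF2 : F f 0 2 < ⊤)
    (hδ2 : ∑' k : ℕ, ENNReal.ofReal ((δ (2 * k))⁻¹ ^ 2) < ⊤) :
    ∃ B : ℝ, 0 ≤ B ∧ ∀ j y, |(f j y)⁻¹| ≤ B := by
  have htop := tsum_tsum_sq_inv_lt_top hf hδ hF2 hδ2
  refine ⟨_, Real.sqrt_nonneg (∑' y, ∑' j, ENNReal.ofReal ((f j y)⁻¹ ^ 2)).toReal,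
    fun j y => Real.abs_le_sqrt ?_⟩
  rw [← ENNReal.ofReal_le_iff_le_toReal htop.ne]
  exact (ENNReal.le_tsum (f := fun j => ENNReal.ofReal ((f j y)⁻¹ ^ 2)) j).trans
    (ENNReal.le_tsum (f := fun y => ∑' j, ENNReal.ofReal ((f j y)⁻¹ ^ 2)) y)

/-- Every traversal of an edge incident to `x` is accompanied by a visit to `x`. -/
lemma traversals_le_two_mul_visits (hX : IsNearestNeighbourPath X) {y : ℕ}
    (hy : y = x ∨ y + 1 = x) (n : ℕ) :
    traversals X n y + (if X n = x then 0 else 1) ≤ 2 * visits X x n + 1 := by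
  -- The extra 1 away from x makes the bound inductive: leaving x may add 2 on the left, matched by
  -- the new visit, and a return trades the extra 1 for a traversal.
  induction n with
  | zero => simp [traversals_zero]; split_ifs <;> omega
  | succ n ih =>
    rw [visits_succ]
    rcases hX n with h | h
    · rw [traversals_succ_of_up h]
      split_ifs at ih ⊢ <;> omega
    · rw [traversals_succ_of_down h]
      split_ifs at ih ⊢ <;> omega

lemma tendsto_visits (h : {n | X n = x}.Infinite) : Tendsto (visits X x) atTop atTop := by
  have hmono : Monotone (visits X x) := monotone_nat_of_le_succ fun n => by
    rw [visits_succ]; omega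
  refine tendsto_atTop_atTop_of_monotone hmono fun b => ?_
  obtain ⟨t, hts, htc⟩ := h.exists_subset_card_eq b
  refine ⟨t.sup id + 1, ?_⟩
  rw [← htc]
  refine card_le_card fun i hi => ?_
  exact mem_filter.2 ⟨mem_range.2 (Nat.lt_succ_of_le (le_sup (f := id) hi)), hts hi⟩

/-! ### Weights at a vertex in terms of its number of visits -/

lemma leftWeight_nonneg (hf : IsReinforcementScheme f) (z : ℕ) : 0 ≤ leftWeight f X n z := by
  cases z with
  | zero => exact le_rfl
  | succ z => exact (hf.pos _ _).le

/-- Total initial weight of the edges incident to `x`. -/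
noncomputable def initialWeightAt (f : ℕ → ℕ → ℝ) (x : ℕ) : ℝ :=
  leftWeight f (fun _ => 0) 0 x + f 0 x

lemma initialWeightAt_pos (hf : IsReinforcementScheme f) (x : ℕ) : 0 < initialWeightAt f x :=
  add_pos_of_nonneg_of_pos (leftWeight_nonneg hf x) (hf.pos 0 x)

lemma weight_le_of_incident (hs : IsReinforcementScheme f) (hf : IsFTR f δ) (hδ : IsDownOnly δ)
    (hX : IsNearestNeighbourPath X) {y : ℕ} (hy : y = x ∨ y + 1 = x) (n : ℕ) :
    weight f X n y ≤ δ (2 * visits X x n) * f 0 y := by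
  rw [weight, hf.factor]
  refine mul_le_mul_of_nonneg_right ?_ (hs.pos _ _).le
  rw [hδ.even_odd]
  exact hδ.mono ((Nat.le_add_right _ _).trans (traversals_le_two_mul_visits hX hy n))

lemma leftWeight_add_weight_le (hs : IsReinforcementScheme f) (hf : IsFTR f δ) (hδ : IsDownOnly δ)
    (hX : IsNearestNeighbourPath X) (n : ℕ) :
    leftWeight f X n x + weight f X n x ≤ δ (2 * visits X x n) * initialWeightAt f x := by
  rw [initialWeightAt, mul_add]
  refine add_le_add ?_ (weight_le_of_incident hs hf hδ hX (Or.inl rfl) n)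
  cases x with
  | zero => simp [leftWeight]
  | succ x =>
    simpa [leftWeight, weight, traversals_zero]
      using weight_le_of_incident hs hf hδ hX (Or.inr rfl) n

lemma tendsto_sum_range_atTop_of_tsum_ofReal_eq_top {g : ℕ → ℝ} (hg : ∀ k, 0 ≤ g k)
    (h : ∑' k, ENNReal.ofReal (g k) = ⊤) :
    Tendsto (fun n => ∑ k ∈ range n, g k) atTop atTop := by
  rw [← not_summable_iff_tendsto_nat_atTop_of_nonneg hg]
  exact fun hs => hs.tsum_ofReal_ne_top h

/-- Change of variable from time to the index of the visit, counted from 0. -/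
lemma sum_ite_visits (X : ℕ → ℕ) (x : ℕ) (g : ℕ → ℝ) (n : ℕ) :
    ∑ i ∈ range n, (if X i = x then g (visits X x i) else 0) = ∑ k ∈ range (visits X x n), g k := by
  induction n with
  | zero => simp [visits]
  | succ n ih =>
    rw [sum_range_succ, ih, visits_succ]
    split_ifs
    · rw [sum_range_succ]
    · simp

/-- If `x` is visited infinitely often, the inverse total weights at `x` seen at these visits
sum up to infinity. -/
lemma tendsto_sum_inv_weights (hs : IsReinforcementScheme f) (hf : IsFTR f δ) (hδ : IsDownOnly δ)
    (hδ1 : ∑' k : ℕ, ENNReal.ofReal ((δ (2 * k))⁻¹) = ⊤)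
    (hX : IsNearestNeighbourPath X) (h : {n | X n = x}.Infinite) :
    Tendsto (fun n => ∑ i ∈ range n,
      if X i = x then (leftWeight f X i x + weight f X i x)⁻¹ else 0) atTop atTop := by
  have hc : 0 < (initialWeightAt f x)⁻¹ := inv_pos.2 (initialWeightAt_pos hs x)
  have h1 : Tendsto (fun n => (initialWeightAt f x)⁻¹ *
      ∑ k ∈ range (visits X x n), (δ (2 * k))⁻¹) atTop atTop :=
    ((tendsto_sum_range_atTop_of_tsum_ofReal_eq_top
      (fun k => (inv_pos.2 (hf.pos _)).le) hδ1).comp (tendsto_visits h)).const_mul_atTop hc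
  refine tendsto_atTop_mono (fun n => ?_) h1
  rw [← sum_ite_visits X x (fun k => (δ (2 * k))⁻¹), mul_sum]
  refine sum_le_sum fun i _ => ?_
  split_ifs
  · rw [← mul_inv, mul_comm]
    exact inv_anti₀ (add_pos_of_nonneg_of_pos (leftWeight_nonneg hs x) (hs.pos _ _))
      (leftWeight_add_weight_le hs hf hδ hX i)
  · simp

end Path

/-! ### Measurability with respect to the history -/

section Measurability

variable {Ω : Type*} {X : ℕ → Ω → ℕ} {f : ℕ → ℕ → ℝ}

/-- A functional of the path that only depends on the first steps is measurable with respect to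
the corresponding history. -/
lemma measurable_history_of_congr {β : Type*} [MeasurableSpace β] {n : ℕ} {g : (ℕ → ℕ) → β}
    (hg : ∀ A B : ℕ → ℕ, (∀ i ≤ n, A i = B i) → g A = g B) :
    Measurable[history X n] fun ω => g fun m => X m ω := by
  have h1 : Measurable[history X n] fun ω => fun i : Fin (n + 1) => X i ω := by
    refine @measurable_pi_lambda _ _ _ (history X n) _ _ fun i => ?_
    have hle : MeasurableSpace.comap (X i) ⊤ ≤ history X n :=
      le_iSup₂_of_le (i : ℕ) (Nat.lt_succ_iff.1 i.2) le_rfl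
    exact (comap_measurable (X i)).mono hle le_rfl
  -- Freezing the path after time n leaves the functional unchanged and makes it a function on a
  -- countable space.
  have h2 : (fun ω => g fun m => X m ω)
      = (fun z : Fin (n + 1) → ℕ => g fun m => z ⟨min m n, by omega⟩) ∘
        fun ω => fun i : Fin (n + 1) => X i ω := by
    funext ω
    exact hg _ _ fun i hi => by simp [hi]
  rw [h2]
  exact (measurable_of_countable _).comp h1

variable {n : ℕ} {A B : ℕ → ℕ}

lemma traversals_congr (h : ∀ i ≤ n, A i = B i) (y : ℕ) : traversals A n y = traversals B n y := by
  unfold traversals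
  congr 1
  refine filter_congr fun i hi => ?_
  have hi := mem_range.1 hi
  rw [h i hi.le, h (i + 1) hi]

lemma weight_congr (h : ∀ i ≤ n, A i = B i) (y : ℕ) : weight f A n y = weight f B n y := by
  rw [weight, weight, traversals_congr h]

lemma leftWeight_congr (h : ∀ i ≤ n, A i = B i) (y : ℕ) :
    leftWeight f A n y = leftWeight f B n y := by
  cases y with
  | zero => rfl
  | succ y => exact weight_congr h y

lemma rightResistance_congr (h : ∀ i ≤ n, A i = B i) (x : ℕ) :
    rightResistance f x A n = rightResistance f x B n := by
  rw [rightResistance, rightResistance, weight_congr h, h n le_rfl]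

lemma leftResistance_congr (h : ∀ i ≤ n, A i = B i) (x : ℕ) :
    leftResistance f x A n = leftResistance f x B n := by
  rw [leftResistance, leftResistance, leftWeight_congr h, h n le_rfl]

lemma resistanceIncrement_congr (h : ∀ i ≤ n + 1, A i = B i) (x : ℕ) :
    resistanceIncrement f x A n = resistanceIncrement f x B n := by
  have h' : ∀ i ≤ n, A i = B i := fun i hi => h i (hi.trans n.le_succ)
  rw [resistanceIncrement, resistanceIncrement, rightResistance_congr h', leftResistance_congr h',
    h (n + 1) le_rfl, h' n le_rfl]

/-- The filtration generated by the walk. -/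
def historyFiltration [mΩ : MeasurableSpace Ω] (hX : ∀ n, Measurable (X n)) : Filtration ℕ mΩ where
  seq := history X
  mono' := fun _ _ hij => biSup_mono fun _ hk => hk.trans hij
  le' := fun _ => iSup₂_le fun i _ => (hX i).comap_le

end Measurability

/-! ### Conditional expectations and almost sure behaviour -/

section Walk

variable {Ω : Type*} [MeasurableSpace Ω] {P : Measure Ω}
  {f : ℕ → ℕ → ℝ} {X : ℕ → Ω → ℕ} {δ : ℕ → ℝ}

lemma IsERRW.ae_isNearestNeighbourPath (hX : IsERRW P f X) :
    ∀ᵐ ω ∂P, IsNearestNeighbourPath fun n => X n ω :=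
  ae_all_iff.2 hX.nearest_neighbour

lemma IsERRW.measurableSet_up (hX : IsERRW P f X) (n : ℕ) :
    MeasurableSet {ω | X (n + 1) ω = X n ω + 1} :=
  measurableSet_eq_fun (hX.measurable _) ((measurable_of_countable (· + 1)).comp (hX.measurable n))

lemma IsERRW.condExp_up_mul [IsProbabilityMeasure P] (hX : IsERRW P f X) {n : ℕ} {g : Ω → ℝ}
    (hg : Measurable[history X n] g) {C : ℝ} (hC : ∀ ω, |g ω| ≤ C) :
    P[({ω | X (n + 1) ω = X n ω + 1}.indicator fun _ => (1 : ℝ)) * g | history X n]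
      =ᵐ[P] fun ω => upProb f (fun m => X m ω) n * g ω := by
  have hU : Integrable ({ω | X (n + 1) ω = X n ω + 1}.indicator fun _ => (1 : ℝ)) P :=
    (integrable_const _).indicator (hX.measurableSet_up n)
  have hgm : Measurable g := hg.mono ((historyFiltration hX.measurable).le n) le_rfl
  have hUg := hU.mul_bdd (c := C) hgm.aestronglyMeasurable (ae_of_all _ hC)
  filter_upwards [condExp_mul_of_stronglyMeasurable_right hg.stronglyMeasurable hUg hU,
    hX.condProb_up n] with ω h1 h2
  rw [h1, Pi.mul_apply, h2]

/-- The resistance increments of walks started in `[0, x]`. -/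
noncomputable def restrictedIncrement (f : ℕ → ℕ → ℝ) (x : ℕ) (A : ℕ → ℕ) (n : ℕ) : ℝ :=
  if A 0 ≤ x then resistanceIncrement f x A n else 0

/-- The expected resistance increment only charges the visits to `x`. -/
lemma IsERRW.condExp_restrictedIncrement [IsProbabilityMeasure P] (hX : IsERRW P f X)
    {B : ℝ} (hB0 : 0 ≤ B)
    (hB : ∀ j y, |(f j y)⁻¹| ≤ B) (x n : ℕ) :
    P[fun ω => restrictedIncrement f x (fun m => X m ω) n | history X n]
      =ᵐ[P] fun ω => if X 0 ω ≤ x ∧ X n ω = x then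
        (leftWeight f (fun m => X m ω) n x + weight f (fun m => X m ω) n x)⁻¹ else 0 := by
  set r : (ℕ → ℕ) → ℝ := fun A => if A 0 ≤ x then rightResistance f x A n else 0 with hr
  set l : (ℕ → ℕ) → ℝ := fun A => if A 0 ≤ x then leftResistance f x A n else 0 with hl
  have hrm : Measurable[history X n] fun ω => r fun m => X m ω :=
    measurable_history_of_congr fun A A' h => by
      simp only [hr, rightResistance_congr h, h 0 (Nat.zero_le n)]
  have hlm : Measurable[history X n] fun ω => l fun m => X m ω :=
    measurable_history_of_congr fun A A' h => by
      simp only [hl, leftResistance_congr h, h 0 (Nat.zero_le n)]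
  have hrb : ∀ A, |r A| ≤ B := fun A => by
    simp only [hr, rightResistance]
    split_ifs
    · exact hB _ _
    all_goals simpa using hB0
  have hlb : ∀ A, |l A| ≤ B := fun A => by
    simp only [hl, leftResistance]
    split_ifs
    · rw [leftWeight_of_pos (by omega)]; exact hB _ _
    all_goals simpa using hB0
  have hsm := (historyFiltration hX.measurable).le n
  have hli : Integrable (fun ω => l fun m => X m ω) P :=
    Integrable.of_bound (hlm.mono hsm le_rfl).aestronglyMeasurable B (ae_of_all _ fun ω => hlb fun m => X m ω)
  set g : Ω → ℝ := fun ω => r (fun m => X m ω) + l (fun m => X m ω) with hg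
  have hgm : Measurable[history X n] g := hrm.add hlm
  have hgb : ∀ ω, |g ω| ≤ B + B := fun ω =>
    (abs_add_le _ _).trans (add_le_add (hrb fun m => X m ω) (hlb fun m => X m ω))
  have hU : Integrable ({ω | X (n + 1) ω = X n ω + 1}.indicator fun _ => (1 : ℝ)) P :=
    (integrable_const _).indicator (hX.measurableSet_up n)
  have hUg : Integrable (({ω | X (n + 1) ω = X n ω + 1}.indicator fun _ => (1 : ℝ)) * g) P :=
    hU.mul_bdd (c := B + B) (hgm.mono hsm le_rfl).aestronglyMeasurable (ae_of_all _ hgb)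
  -- With U the event of an up-step, the increment is 1_U r - 1_{Uᶜ} l = 1_U (r + l) - l, so only
  -- the conditional probability of U is needed.
  have heq : (fun ω => restrictedIncrement f x (fun m => X m ω) n)
      = ({ω | X (n + 1) ω = X n ω + 1}.indicator fun _ => (1 : ℝ)) * g
        - fun ω => l fun m => X m ω := by
    funext ω
    by_cases h0 : X 0 ω ≤ x <;> by_cases hu : X (n + 1) ω = X n ω + 1 <;>
      simp [restrictedIncrement, resistanceIncrement, hg, hr, hl, h0, hu]
  have hlc := condExp_of_stronglyMeasurable hsm hlm.stronglyMeasurable hli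
  rw [heq]
  filter_upwards [condExp_sub hUg hli (history X n), hX.condExp_up_mul hgm hgb] with ω h1 h2
  rw [h1, Pi.sub_apply, h2]
  refine (congrArg (fun t => _ - t) (congrFun hlc ω)).trans ?_
  by_cases h0 : X 0 ω ≤ x
  swap
  · simp [hg, hr, hl, h0]
  have hw : 0 < weight f (fun m => X m ω) n (X n ω) := hX.scheme.pos _ _
  simp only [hg, hr, hl, h0, upProb, rightResistance, leftResistance, if_true, true_and]
  -- Left of x both resistances vanish. At x only the right one remains, and its weight cancels the
  -- numerator of the jump probability. Right of x the two contributions cancel.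
  rcases lt_trichotomy (X n ω) x with h | h | h
  · simp [h.not_ge, h.le.not_gt, h.ne]
  · subst h
    simp only [le_refl, lt_irrefl, if_true, if_false]
    have := leftWeight_nonneg (X := fun m => X m ω) (n := n) hX.scheme (X n ω)
    field_simp
    ring
  · have hlw : 0 < leftWeight f (fun m => X m ω) n (X n ω) := by
      rw [leftWeight_of_pos (by omega)]; exact hX.scheme.pos _ _
    simp only [h.le, h, h.ne', if_true, if_false]
    field_simp
    ring

/-- A vertex to the right of the starting point is almost surely visited finitely often. -/
lemma IsERRW.ae_finite_visits_of_le [IsProbabilityMeasure P] (hX : IsERRW P f X)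
    (hf : IsFTR f δ) (hδ : IsDownOnly δ)
    (hF2 : F f 0 2 < ⊤) (hδ2 : ∑' k : ℕ, ENNReal.ofReal ((δ (2 * k))⁻¹ ^ 2) < ⊤)
    (hδ1 : ∑' k : ℕ, ENNReal.ofReal ((δ (2 * k))⁻¹) = ⊤) (x : ℕ) :
    ∀ᵐ ω ∂P, X 0 ω ≤ x → {n | X n ω = x}.Finite := by
  obtain ⟨K, hK0, hK⟩ := exists_sum_sq_resistanceIncrement_le hf hδ hF2 hδ2
  obtain ⟨B, hB0, hB⟩ := exists_inv_le hf hδ hF2 hδ2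
  have hYm : ∀ n, StronglyMeasurable[historyFiltration hX.measurable (n + 1)]
      fun ω => restrictedIncrement f x (fun m => X m ω) n := fun n =>
    (measurable_history_of_congr (X := X) (n := n + 1)
      (g := fun A => restrictedIncrement f x A n) fun A A' h => by
        simp only [restrictedIncrement, resistanceIncrement_congr h,
          h 0 (Nat.zero_le _)]).stronglyMeasurable
  have hconv := ae_exists_tendsto_sum_sub_condExp (μ := P) hYm (K := K) fun n => by
    filter_upwards [hX.ae_isNearestNeighbourPath] with ω hω
    by_cases h0 : X 0 ω ≤ x
    · simpa [restrictedIncrement, h0] using hK x _ hω n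
    · simpa [restrictedIncrement, h0] using hK0
  have hcond := ae_all_iff.2 (hX.condExp_restrictedIncrement hB0 hB x)
  filter_upwards [hX.ae_isNearestNeighbourPath, hconv, hcond] with ω hω ⟨c, hc⟩ hE h0
  by_contra hinf
  have hdiv := tendsto_sum_inv_weights hX.scheme hf hδ hδ1 hω hinf
  have hfreq : ∃ᶠ n in atTop, X n ω = x := Nat.frequently_atTop_iff_infinite.2 hinf
  -- At a late visit to x the centred sum exceeds c - 1 and the compensator is at least 1 - c. Since
  -- the resistance is then 0, the centred sum is minus the compensator, a contradiction.
  obtain ⟨n, hnx, hn1, hn2⟩ := (hfreq.and_eventually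
    ((hc.eventually (lt_mem_nhds (sub_one_lt c))).and (hdiv.eventually_ge_atTop (1 - c)))).exists
  have hsum : ∑ i ∈ range n, restrictedIncrement f x (fun m => X m ω) i = 0 := by
    have := sum_resistanceIncrement (n := n) hf hδ hω h0
    simp only [hnx, Ico_self, sum_empty] at this
    simpa [restrictedIncrement, h0] using this
  rw [sum_sub_distrib, hsum] at hn1
  have hA : ∑ i ∈ range n, (P[fun ω => restrictedIncrement f x (fun m => X m ω) i |
      historyFiltration hX.measurable i]) ω = ∑ i ∈ range n, if X i ω = x then
        (leftWeight f (fun m => X m ω) i x + weight f (fun m => X m ω) i x)⁻¹ else 0 :=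
    sum_congr rfl fun i _ => (hE i).trans (by simp [h0])
  rw [hA] at hn1
  linarith

/-- By the conditional Borel-Cantelli lemma, the right neighbour of a vertex visited infinitely
often is visited infinitely often. -/
lemma IsERRW.ae_infinite_visits_succ [IsProbabilityMeasure P] (hX : IsERRW P f X)
    (hf : IsFTR f δ) (hδ : IsDownOnly δ)
    (hδ1 : ∑' k : ℕ, ENNReal.ofReal ((δ (2 * k))⁻¹) = ⊤) (x : ℕ) :
    ∀ᵐ ω ∂P, {n | X n ω = x}.Infinite → {n | X n ω = x + 1}.Infinite := by
  set s : ℕ → Set Ω := fun k => {ω | 0 < k ∧ X (k - 1) ω = x ∧ X k ω = x + 1} with hs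
  have hsm : ∀ k, MeasurableSet[historyFiltration hX.measurable k] (s k) := fun k => by
    have := measurable_history_of_congr (X := X) (n := k)
      (g := fun A => (0 < k ∧ A (k - 1) = x ∧ A k = x + 1 : Prop)) fun A A' h => by
        rw [h k le_rfl, h (k - 1) (Nat.sub_le _ _)]
    exact @measurableSet_setOfPred _ (historyFiltration hX.measurable k) _ |>.2 this
  have hind : ∀ k, (s (k + 1)).indicator (1 : Ω → ℝ)
      = ({ω | X (k + 1) ω = X k ω + 1}.indicator fun _ => (1 : ℝ))
        * fun ω => if X k ω = x then 1 else 0 := fun k => by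
    funext ω
    by_cases h : X k ω = x <;> simp [hs, Set.indicator_apply, h]
  have hcond := fun k => hX.condExp_up_mul (n := k) (g := fun ω => if X k ω = x then 1 else 0)
    (measurable_history_of_congr (g := fun A => if A k = x then (1 : ℝ) else 0)
      fun A A' h => by simp only [h k le_rfl]) (C := 1) fun ω => by split_ifs <;> simp
  filter_upwards [hX.ae_isNearestNeighbourPath, ae_all_iff.2 hcond,
    ae_mem_limsup_atTop_iff P hsm] with ω hω hE hBC hinf
  have hdiv := (tendsto_sum_inv_weights hX.scheme hf hδ hδ1 hω hinf).const_mul_atTop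
    (hX.scheme.pos 0 x)
  -- At a visit to x the conditional probability of stepping right is at least f(0,x) over the total
  -- weight at x, and these lower bounds have a divergent sum.
  have hlim : ω ∈ limsup s atTop := by
    refine hBC.2 (tendsto_atTop_mono (fun n => ?_) hdiv)
    rw [mul_sum]
    refine sum_le_sum fun i _ => ?_
    rw [hind]
    refine le_of_le_of_eq ?_ (hE i).symm
    by_cases h : X i ω = x
    · have hw : f 0 x ≤ weight f (fun m => X m ω) i x := hX.scheme.mono x (Nat.zero_le _)
      have hl := leftWeight_nonneg (X := fun m => X m ω) (n := i) hX.scheme x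
      have hp := hX.scheme.pos 0 x
      simp only [h, if_true, upProb, mul_one, div_eq_mul_inv]
      exact mul_le_mul_of_nonneg_right hw (inv_nonneg.2 (add_nonneg hl (hp.le.trans hw)))
    · simp [h]
  rw [mem_limsup_iff_frequently_mem] at hlim
  exact Nat.frequently_atTop_iff_infinite.1 (hlim.mono fun k hk => hk.2.2)

end Walk

end ERRW

theorem proposition3p2 {Ω : Type*} [MeasurableSpace Ω] (P : Measure Ω) [IsProbabilityMeasure P]
    (f : ℕ → ℕ → ℝ) (X : ℕ → Ω → ℕ) (hX : ERRW.IsERRW P f X)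
    (δ : ℕ → ℝ) (hFTR : ERRW.IsFTR f δ) (hDT : ERRW.IsDownOnly δ)
    (hF2 : ERRW.F f 0 2 < ⊤) (hF1 : ERRW.F f 0 1 = ⊤)
    (hδ2 : ∑' k : ℕ, ENNReal.ofReal ((δ (2 * k))⁻¹ ^ 2) < ⊤)
    (hδ1 : ∑' k : ℕ, ENNReal.ofReal ((δ (2 * k))⁻¹) = ⊤) :
    ∀ᵐ ω ∂P, ERRW.IsTransientPath fun n => X n ω := by
  filter_upwards [ae_all_iff.2 (hX.ae_finite_visits_of_le hFTR hDT hF2 hδ2 hδ1),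
    ae_all_iff.2 (hX.ae_infinite_visits_succ hFTR hDT hδ1)] with ω hfin hsucc x
  by_contra hinf
  have hall : ∀ k, {n | X n ω = x + k}.Infinite := fun k => by
    induction k with
    | zero => exact hinf
    | succ k ih => exact hsucc _ ih
  -- Shifting x by X_0 reaches a vertex at or beyond the start, where finiteness is known.
  exact hall (X 0 ω) (hfin (x + X 0 ω) (Nat.le_add_left _ _))
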